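/- Let $(\Sigma,\partial)$ be a differential field of characteristic zero with field of constants $\mathbf{C}=\{a\in\Sigma : \partial(a)=0\}$, let $n\ge 1$, and let $$L=\partial^n+\upsilon_2\partial^{n-2}+\cdots+\upsilon_{n-1}\partial+\upsilon_n\in\Sigma[\partial]$$ be a differential operator of order $n$ in normal form. Notation. Let $\mathbf{C}\{U\}$ be the ring of differential polynomials in the differential variables $U=\{u_2,\dots,u_n\}$, let $L_n=\partial^n+u_2\partial^{n-2}+\cdots+u_n$ be the formal operator, let $Q=L_n^{1/n}$ be its unique monic $n$-th root in the ring of pseudo-differential operators $\mathbf{C}\{U\}((\partial^{-1}))$, and let $P_j=(Q^j)_+$ be the positive part of $Q^j$, for $j\in\mathbb{N}$. Define $H_{k,j}\in\mathbf{C}\{U\}$ by $[P_j,L_n]=\sum_{k=0}^{n-2}H_{k,j}\,\partial^k$, and let $\sigma_{k,j}\in\Sigma$ be the image of $H_{k,j}$ under the homomorphism of differential $\mathbf{C}$-algebras $\mathbf{C}\{U\}\to\Sigma$ with $u_\ell\mapsto\upsilon_\ell$. For $m\in\mathbb{N}$ let $J_{n,m}=\{j : 1\le j\le m,\ n\nmid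 j\}$, and let ${\rm hGD}_{n,m}(L)$ be the linear system $$\sum_{j\in J_{n,m}}c_j\,\sigma_{k,j}=0,\qquad k=0,\dots,n-2,$$ in the unknowns $c_j$, $j\in J_{n,m}$. Let $V_m\subseteq\mathbf{C}^{J_{n,m}}$ be the $\mathbf{C}$-vector space of its solutions with constant entries. Let $\mathcal{Z}(L)$ be the centralizer of $L$ in $\Sigma[\partial]$, let $W_m(L)$ be the space of $A\in\Sigma[\partial]$ of order at most $m$ with ${\rm ord}([L,A])\le n-2$, and let $\mathcal{Z}_m(L)=W_m(L)\cap\mathcal{Z}(L)$. Let $\mathbf{C}[L]$ be the ring of polynomials in $L$ with coefficients in $\mathbf{C}$, and $\mathbf{C}_m[L]$ the subspace of its elements of order at most $m$. By convention ${\rm ord}(0)=-\infty$. 1. For every $m\in\mathbb{N}$ there is an isomorphism of $\mathbf{C}$-vector spaces $$V_m\;\simeq\;\mathcal{Z}_m(L)/\mathbf{C}_m[L].$$ 2. If for every positive integer $m$ not divisible by $n$ the system ${\rm hGD}_{n,m}(L)$ has only the zero solution in constants (that is, $V_m=0$), then the centralizer is trivial: $\mathcal{Z}(L)=\mathbf{C}[L]$.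 -/

import Mathlib

/-- A formal pseudo-differential operator `∑_{i ≤ N} a_i ∂^i` with coefficients in `R`
(`coeff i = a_i`, the sum is infinite downwards only). -/
@[ext]
structure PseudoDiffOp (R : Type*) [CommRing R] where
  coeff : ℤ → R
  exists_bound : ∃ N : ℤ, ∀ i, N < i → coeff i = 0

/-- The `l`-th power of the derivation of a differential ring. -/
def derivPow (R : Type*) [CommRing R] [Differential R] (l : ℕ) : Module.End ℤ R :=
  (Differential.deriv : Derivation ℤ R R).toLinearMap ^ l

section DerivPow

variable {R : Type*} [CommRing R] [Differential R]

theorem derivPow_zero (a : R) : derivPow R 0 a = a := rfl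

theorem derivPow_succ (l : ℕ) (a : R) :
    derivPow R (l + 1) a = Differential.deriv (derivPow R l a) := by
  simp [derivPow, pow_succ']

theorem derivPow_add (l m : ℕ) (a : R) :
    derivPow R (l + m) a = derivPow R l (derivPow R m a) := by
  simp [derivPow, pow_add]

theorem derivPow_one (l : ℕ) (hl : l ≠ 0) : derivPow R l 1 = 0 := by
  obtain ⟨k, rfl⟩ := Nat.exists_eq_succ_of_ne_zero hl
  rw [Nat.succ_eq_add_one, derivPow_add]
  simp [derivPow]

theorem derivPow_mul (n : ℕ) (a b : R) :
    derivPow R n (a * b) =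
      ∑ p ∈ Finset.HasAntidiagonal.antidiagonal n, (n.choose p.1 : R) * (derivPow R p.1 a * derivPow R p.2 b) := by
  induction n with
  | zero => simp [derivPow_zero]
  | succ n ih =>
    rw [Finset.sum_antidiagonal_choose_succ_mul
      (fun i j => derivPow R i a * derivPow R j b) n, derivPow_succ, ih]
    simp only [map_sum, ← Finset.sum_add_distrib]
    refine Finset.sum_congr rfl fun ⟨i, j⟩ hij => ?_
    rw [n.choose_symm_of_eq_add (Finset.HasAntidiagonal.mem_antidiagonal.1 hij).symm]
    simp only [derivPow_succ, Derivation.leibniz, smul_eq_mul, Derivation.map_natCast]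
    ring

theorem derivPow_const_mul {c : R} (hc : Differential.deriv c = 0) (l : ℕ) (a : R) :
    derivPow R l (c * a) = c * derivPow R l a := by
  induction l with
  | zero => simp [derivPow_zero]
  | succ l ih => simp [derivPow_succ, ih, hc]

end DerivPow

theorem finsum_sum_antidiagonal {α R : Type*} [AddCommMonoid R] (g : α × ℕ × ℕ → R)
    (hg : g.support.Finite) :
    ∑ᶠ z : α × ℕ, ∑ p ∈ Finset.HasAntidiagonal.antidiagonal z.2, g (z.1, p.1, p.2) = ∑ᶠ w, g w := by
  classical
  set φ : α × ℕ × ℕ → α × ℕ := fun w => (w.1, w.2.1 + w.2.2)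
  have key : ∀ z : α × ℕ, ∑ p ∈ Finset.HasAntidiagonal.antidiagonal z.2, g (z.1, p.1, p.2) =
      ∑ w ∈ hg.toFinset with φ w = z, g w := by
    rintro ⟨x, n⟩
    have h1 : ∑ p ∈ Finset.HasAntidiagonal.antidiagonal n, g (x, p.1, p.2) =
        ∑ w ∈ (Finset.HasAntidiagonal.antidiagonal n).image (fun p => (x, p)), g w := by
      rw [Finset.sum_image (by intro a _ b _ h; simpa using h)]
    rw [h1]
    symm
    apply Finset.sum_subset
    · rintro ⟨y, p⟩ hp
      simp only [Finset.mem_filter, φ, Prod.mk.injEq] at hp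
      simp [hp.2.1, hp.2.2]
    · rintro ⟨y, p⟩ hp hn
      simp only [Finset.mem_image, Finset.HasAntidiagonal.mem_antidiagonal, Prod.mk.injEq] at hp
      obtain ⟨q, hq, rfl, rfl⟩ := hp
      by_contra hne
      exact hn (by simp [φ, hq, hne])
  simp_rw [key]
  rw [finsum_eq_sum_of_support_subset (s := hg.toFinset.image φ),
    finsum_eq_sum_of_support_subset (s := hg.toFinset) g (by simp)]
  · exact Finset.sum_fiberwise_of_maps_to (fun w hw => Finset.mem_image_of_mem _ hw) g
  · intro z hz
    obtain ⟨w, hw, -⟩ := Finset.exists_ne_zero_of_sum_ne_zero hz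
    rw [Finset.mem_filter] at hw
    simp only [Finset.coe_image, Set.mem_image]
    exact ⟨w, by simpa using hw.1, hw.2⟩

namespace PseudoDiffOp

section Basic

variable {R : Type*} [CommRing R]

instance : Zero (PseudoDiffOp R) := ⟨⟨0, 0, fun _ _ => rfl⟩⟩

instance : Add (PseudoDiffOp R) :=
  ⟨fun A B => ⟨A.coeff + B.coeff, by
    obtain ⟨N, hN⟩ := A.exists_bound
    obtain ⟨M, hM⟩ := B.exists_bound
    exact ⟨max N M, fun i hi => by simp [hN i (by omega), hM i (by omega)]⟩⟩⟩

instance : Neg (PseudoDiffOp R) :=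
  ⟨fun A => ⟨-A.coeff, by
    obtain ⟨N, hN⟩ := A.exists_bound
    exact ⟨N, fun i hi => by simp [hN i hi]⟩⟩⟩

theorem coeff_zero (i : ℤ) : (0 : PseudoDiffOp R).coeff i = 0 := rfl

theorem coeff_add (A B : PseudoDiffOp R) (i : ℤ) : (A + B).coeff i = A.coeff i + B.coeff i := rfl

theorem coeff_neg (A : PseudoDiffOp R) (i : ℤ) : (-A).coeff i = -A.coeff i := rfl

instance : AddCommGroup (PseudoDiffOp R) where
  add_assoc A B C := by ext i; exact add_assoc _ _ _
  zero_add A := by ext i; exact zero_add _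
  add_zero A := by ext i; exact add_zero _
  add_comm A B := by ext i; exact add_comm _ _
  neg_add_cancel A := by ext i; exact neg_add_cancel _
  nsmul := nsmulRec
  zsmul := zsmulRec

/-- The monomial `a ∂^j`. -/
def monomial (j : ℤ) (a : R) : PseudoDiffOp R :=
  ⟨fun i => if i = j then a else 0, j, fun _ hi => if_neg (by omega)⟩

theorem coeff_monomial (j : ℤ) (a : R) (i : ℤ) :
    (monomial j a).coeff i = if i = j then a else 0 := rfl

instance : One (PseudoDiffOp R) := ⟨monomial 0 1⟩

theorem coeff_one (i : ℤ) : (1 : PseudoDiffOp R).coeff i = if i = 0 then 1 else 0 := rfl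

theorem triple_bound (A B C : PseudoDiffOp R) (k : ℤ) : ∃ (N : ℕ), ∀ (i j : ℤ) (l p t : ℕ),
    A.coeff i ≠ 0 → B.coeff j ≠ 0 → C.coeff (k - i - j + l + (p + t : ℕ)) ≠ 0 →
    -(N : ℤ) ≤ i ∧ i ≤ N ∧ -(N : ℤ) ≤ j ∧ j ≤ N ∧ l ≤ N ∧ p ≤ N ∧ t ≤ N := by
  obtain ⟨N1, h1⟩ := A.exists_bound
  obtain ⟨N2, h2⟩ := B.exists_bound
  obtain ⟨N3, h3⟩ := C.exists_bound
  refine ⟨N1.natAbs + N2.natAbs + N3.natAbs + k.natAbs, fun i j l p t hi hj hm => ?_⟩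
  have e1 : i ≤ N1 := by by_contra hc; exact hi (h1 i (by omega))
  have e2 : j ≤ N2 := by by_contra hc; exact hj (h2 j (by omega))
  have e3 : k - i - j + l + (p + t : ℕ) ≤ N3 := by
    by_contra hc; exact hm (h3 _ (by omega))
  push_cast at e3
  omega

end Basic

section Mul

variable {R : Type*} [CommRing R] [Differential R]

/-- The summand indexed by `p = (i, l)` of the coefficient of `∂^k` in a product, coming from
`∂^i ∘ b = ∑_l binom(i, l) b^{(l)} ∂^(i-l)`. -/
def mulTerm (A B : PseudoDiffOp R) (k : ℤ) (p : ℤ × ℕ) : R :=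
  (Ring.choose p.1 p.2 : ℤ) * (A.coeff p.1 * derivPow R p.2 (B.coeff (k - p.1 + p.2)))

theorem finite_mulTerm (A B : PseudoDiffOp R) (k : ℤ) : (mulTerm A B k).support.Finite := by
  obtain ⟨N, hN⟩ := A.exists_bound
  obtain ⟨M, hM⟩ := B.exists_bound
  refine ((Set.finite_Icc (k - M) N).prod (Set.finite_Iic (N + M - k).toNat)).subset ?_
  rintro ⟨i, l⟩ h
  have h1 : i ≤ N := by
    by_contra hc
    exact h (by simp [mulTerm, hN i (by omega)])
  have h2 : k - i + l ≤ M := by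
    by_contra hc
    exact h (by simp [mulTerm, hM (k - i + l) (by omega)])
  simp only [Set.mem_prod, Set.mem_Icc, Set.mem_Iic]
  omega

/-- The product of pseudo-differential operators, determined by
`∂^i ∘ b = ∑_{l ≥ 0} binom(i, l) b^{(l)} ∂^(i-l)` for all integers `i`. -/
noncomputable instance : Mul (PseudoDiffOp R) :=
  ⟨fun A B => ⟨fun k => ∑ᶠ p : ℤ × ℕ, mulTerm A B k p, by
    obtain ⟨N, hN⟩ := A.exists_bound
    obtain ⟨M, hM⟩ := B.exists_bound
    refine ⟨N + M, fun k hk => ?_⟩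
    rw [← finsum_zero (α := ℤ × ℕ)]
    congr 1
    ext ⟨i, l⟩
    by_cases h : N < i
    · simp [mulTerm, hN i h]
    · simp [mulTerm, hM (k - i + l) (by omega)]⟩⟩

theorem coeff_mul (A B : PseudoDiffOp R) (k : ℤ) :
    (A * B).coeff k = ∑ᶠ p : ℤ × ℕ, mulTerm A B k p := rfl

protected theorem add_mul (A B C : PseudoDiffOp R) : (A + B) * C = A * C + B * C := by
  ext k
  rw [coeff_add, coeff_mul, coeff_mul, coeff_mul,
    ← finsum_add_distrib (finite_mulTerm A C k) (finite_mulTerm B C k)]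
  refine finsum_congr fun p => ?_
  simp only [mulTerm, coeff_add]
  ring

protected theorem mul_add (A B C : PseudoDiffOp R) : A * (B + C) = A * B + A * C := by
  ext k
  rw [coeff_add, coeff_mul, coeff_mul, coeff_mul,
    ← finsum_add_distrib (finite_mulTerm A B k) (finite_mulTerm A C k)]
  refine finsum_congr fun p => ?_
  simp only [mulTerm, coeff_add, map_add]
  ring

theorem monomial_mul_coeff_zero (c : R) (A : PseudoDiffOp R) (k : ℤ) :
    (monomial 0 c * A).coeff k = c * A.coeff k := by
  rw [coeff_mul, finsum_eq_single _ ((0, 0) : ℤ × ℕ)]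
  · simp [mulTerm, coeff_monomial, derivPow_zero]
  · rintro ⟨i, l⟩ h
    by_cases hi : i = 0
    · subst hi
      have hl : l ≠ 0 := by rintro rfl; exact h rfl
      obtain ⟨m, rfl⟩ := Nat.exists_eq_succ_of_ne_zero hl
      simp [mulTerm]
    · simp [mulTerm, coeff_monomial, hi]

protected theorem mul_one (A : PseudoDiffOp R) : A * 1 = A := by
  ext k
  rw [coeff_mul, finsum_eq_single _ ((k, 0) : ℤ × ℕ)]
  · simp [mulTerm, coeff_one, derivPow_zero]
  · rintro ⟨i, l⟩ h
    by_cases hl : l = 0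
    · subst hl
      have : k - i ≠ 0 := fun hc => h (by simp; omega)
      simp [mulTerm, coeff_one, this]
    · simp only [mulTerm, coeff_one]
      split_ifs <;> simp [derivPow_one l hl]

/-- The common expansion of both ways of bracketing a triple product. -/
def tripleTerm (A B C : PseudoDiffOp R) (k i j : ℤ) (l p t : ℕ) : R :=
  ((Ring.choose i l * Ring.choose (i - l) p * Ring.choose j t : ℤ) : R) *
    (A.coeff i * (derivPow R l (B.coeff j) *
      derivPow R (p + t) (C.coeff (k - i - j + l + (p + t : ℕ)))))

theorem coeff_ne_of_tripleTerm {A B C : PseudoDiffOp R} {k i j : ℤ} {l p t : ℕ}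
    (h : tripleTerm A B C k i j l p t ≠ 0) :
    A.coeff i ≠ 0 ∧ B.coeff j ≠ 0 ∧ C.coeff (k - i - j + l + (p + t : ℕ)) ≠ 0 := by
  refine ⟨fun h' => h ?_, fun h' => h ?_, fun h' => h ?_⟩ <;> rw [tripleTerm, h'] <;> simp

theorem finite_tripleTerm (A B C : PseudoDiffOp R) (k : ℤ) :
    (fun w : (ℤ × ℤ × ℕ) × ℕ × ℕ =>
      tripleTerm A B C k w.1.1 w.1.2.1 w.1.2.2 w.2.1 w.2.2).support.Finite := by
  obtain ⟨N, hN⟩ := triple_bound A B C k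
  refine (((Set.finite_Icc (-(N : ℤ)) N).prod ((Set.finite_Icc (-(N : ℤ)) N).prod
    (Set.finite_Iic N))).prod ((Set.finite_Iic N).prod (Set.finite_Iic N))).subset ?_
  rintro ⟨⟨i, j, l⟩, p, t⟩ h
  obtain ⟨h1, h2, h3⟩ := coeff_ne_of_tripleTerm h
  have := hN i j l p t h1 h2 h3
  simp only [Set.mem_prod, Set.mem_Icc, Set.mem_Iic]
  omega

theorem coeff_mul_mul_left (A B C : PseudoDiffOp R) (k : ℤ) :
    (A * B * C).coeff k = ∑ᶠ w : (ℤ × ℤ × ℕ) × ℕ × ℕ,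
      tripleTerm A B C k w.1.1 w.1.2.1 w.1.2.2 w.2.1 w.2.2 := by
  have hsum : ∀ (i j : ℤ) (l q : ℕ),
      ∑ z ∈ Finset.HasAntidiagonal.antidiagonal q, tripleTerm A B C k i j l z.1 z.2 =
      ((Ring.choose (i + j - l) q * Ring.choose i l : ℤ) : R) *
        (A.coeff i * (derivPow R l (B.coeff j) *
          derivPow R q (C.coeff (k - i - j + l + q)))) := by
    intro i j l q
    have hch := Ring.add_choose_eq (r := i - (l : ℤ)) (s := j) q (Commute.all _ _)
    rw [show i - (l : ℤ) + j = i + j - l by ring] at hch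
    rw [hch, mul_comm (∑ _ ∈ _, _), Finset.mul_sum, Int.cast_sum, Finset.sum_mul]
    refine Finset.sum_congr rfl fun z hz => ?_
    rw [Finset.HasAntidiagonal.mem_antidiagonal] at hz
    simp only [tripleTerm, hz, mul_assoc]
  rw [← finsum_sum_antidiagonal _ (finite_tripleTerm A B C k)]
  set G : (ℤ × ℕ) × ℤ × ℕ → R := fun u =>
    mulTerm A B u.1.1 u.2 * ((Ring.choose u.1.1 u.1.2 : ℤ) : R) *
      derivPow R u.1.2 (C.coeff (k - u.1.1 + u.1.2)) with hG
  let e : (ℤ × ℕ) × ℤ × ℕ ≃ (ℤ × ℤ × ℕ) × ℕ :=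
    { toFun := fun u => ((u.2.1, u.1.1 - u.2.1 + u.2.2, u.2.2), u.1.2)
      invFun := fun v => ((v.1.1 + v.1.2.1 - v.1.2.2, v.2), v.1.1, v.1.2.2)
      left_inv := by
        rintro ⟨⟨s, q⟩, i, l⟩
        simp only [Prod.mk.injEq, and_true]
        ring
      right_inv := by
        rintro ⟨⟨i, j, l⟩, q⟩
        simp only [Prod.mk.injEq, and_true, true_and]
        ring }
  have hGe : ∀ u, G u = ∑ z ∈ Finset.HasAntidiagonal.antidiagonal (e u).2,
      tripleTerm A B C k (e u).1.1 (e u).1.2.1 (e u).1.2.2 z.1 z.2 := by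
    rintro ⟨⟨s, q⟩, i, l⟩
    rw [hsum]
    simp only [hG, e, mulTerm, Equiv.coe_fn_mk]
    rw [show i + (s - i + l) - (l : ℤ) = s by ring,
      show k - i - (s - i + l) + (l : ℤ) + q = k - s + q by ring]
    push_cast
    ring
  have hfin : G.support.Finite := by
    obtain ⟨N, hN⟩ := triple_bound A B C k
    refine (((Set.finite_Icc (-(3 * N : ℤ)) (3 * N)).prod (Set.finite_Iic (2 * N))).prod
      ((Set.finite_Icc (-(N : ℤ)) N).prod (Set.finite_Iic N))).subset ?_
    rintro ⟨⟨s, q⟩, i, l⟩ h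
    rw [Function.mem_support, hGe] at h
    obtain ⟨⟨p, t⟩, hz, hne⟩ := Finset.exists_ne_zero_of_sum_ne_zero h
    obtain ⟨h1, h2, h3⟩ := coeff_ne_of_tripleTerm hne
    have := hN _ _ _ _ _ h1 h2 h3
    simp only [e, Equiv.coe_fn_mk, Finset.HasAntidiagonal.mem_antidiagonal] at this hz
    simp only [Set.mem_prod, Set.mem_Icc, Set.mem_Iic]
    omega
  rw [← finsum_comp_equiv e]
  simp only [← hGe]
  rw [finsum_curry _ hfin, coeff_mul]
  refine finsum_congr fun x => ?_
  rw [mulTerm, coeff_mul, finsum_mul' _ _ (finite_mulTerm A B x.1), mul_finsum']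
  · exact finsum_congr fun y => by simp only [hG]; ring
  · refine (finite_mulTerm A B x.1).subset fun y hy h => hy ?_
    simp [h]

theorem coeff_mul_mul_right (A B C : PseudoDiffOp R) (k : ℤ) :
    (A * (B * C)).coeff k = ∑ᶠ w : (ℤ × ℤ × ℕ) × ℕ × ℕ,
      tripleTerm A B C k w.1.1 w.1.2.1 w.1.2.2 w.2.1 w.2.2 := by
  let e₁ : (ℤ × ℤ × ℕ) × ℕ × ℕ ≃ (ℤ × ℤ × ℕ) × ℕ × ℕ :=
    { toFun := fun w => ((w.1.1, w.1.2.1, w.2.2), w.1.2.2, w.2.1)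
      invFun := fun w => ((w.1.1, w.1.2.1, w.2.1), w.2.2, w.1.2.2)
      left_inv := by rintro ⟨⟨i, j, l⟩, p, t⟩; rfl
      right_inv := by rintro ⟨⟨i, j, t⟩, l, p⟩; rfl }
  set T : (ℤ × ℤ × ℕ) × ℕ × ℕ → R := fun w =>
    tripleTerm A B C k w.1.1 w.1.2.1 w.2.1 w.2.2 w.1.2.2 with hT
  have hTfin : T.support.Finite :=
    ((finite_tripleTerm A B C k).preimage e₁.symm.injective.injOn).subset fun w hw => hw
  have hcomp : ∑ᶠ w : (ℤ × ℤ × ℕ) × ℕ × ℕ,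
      tripleTerm A B C k w.1.1 w.1.2.1 w.1.2.2 w.2.1 w.2.2 = ∑ᶠ w, T w := by
    rw [← finsum_comp_equiv e₁.symm]
    rfl
  rw [hcomp, ← finsum_sum_antidiagonal _ hTfin]
  have hsum : ∀ (i j : ℤ) (t r : ℕ),
      ∑ z ∈ Finset.HasAntidiagonal.antidiagonal r, tripleTerm A B C k i j z.1 z.2 t =
      ((Ring.choose i r * Ring.choose j t : ℤ) : R) * (A.coeff i *
        derivPow R r (B.coeff j * derivPow R t (C.coeff (k - i - j + r + t)))) := by
    intro i j t r
    rw [derivPow_mul, Finset.mul_sum, Finset.mul_sum]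
    refine Finset.sum_congr rfl fun z hz => ?_
    rw [Finset.HasAntidiagonal.mem_antidiagonal] at hz
    have hch := Ring.choose_smul_choose i (show z.1 ≤ r by omega)
    rw [show r - z.1 = z.2 by omega, nsmul_eq_mul] at hch
    rw [tripleTerm, ← hch, ← derivPow_add,
      show k - i - j + r + (t : ℤ) = k - i - j + z.1 + (z.2 + t : ℕ) by push_cast [← hz]; ring]
    push_cast
    ring
  set G : (ℤ × ℕ) × ℤ × ℕ → R := fun u =>
    ((Ring.choose u.1.1 u.1.2 : ℤ) : R) * (A.coeff u.1.1 *
      derivPow R u.1.2 (mulTerm B C (k - u.1.1 + u.1.2) u.2)) with hG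
  let e : (ℤ × ℕ) × ℤ × ℕ ≃ (ℤ × ℤ × ℕ) × ℕ :=
    { toFun := fun u => ((u.1.1, u.2.1, u.2.2), u.1.2)
      invFun := fun v => ((v.1.1, v.2), v.1.2.1, v.1.2.2)
      left_inv := by rintro ⟨⟨s, q⟩, i, l⟩; rfl
      right_inv := by rintro ⟨⟨i, j, l⟩, q⟩; rfl }
  have hGe : ∀ u, G u = ∑ z ∈ Finset.HasAntidiagonal.antidiagonal (e u).2,
      T ((e u).1, z.1, z.2) := by
    rintro ⟨⟨i, r⟩, j, t⟩
    simp only [hT, e, Equiv.coe_fn_mk]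
    rw [hsum]
    simp only [hG, mulTerm]
    rw [derivPow_const_mul (by simp),
      show k - i - j + r + (t : ℤ) = k - i + r - j + t by ring]
    push_cast
    ring
  have hfin : G.support.Finite := by
    obtain ⟨N, hN⟩ := triple_bound A B C k
    refine (((Set.finite_Icc (-(N : ℤ)) N).prod (Set.finite_Iic (2 * N))).prod
      ((Set.finite_Icc (-(N : ℤ)) N).prod (Set.finite_Iic N))).subset ?_
    rintro ⟨⟨i, r⟩, j, t⟩ h
    rw [Function.mem_support, hGe] at h
    obtain ⟨⟨p, t⟩, hz, hne⟩ := Finset.exists_ne_zero_of_sum_ne_zero h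
    obtain ⟨h1, h2, h3⟩ := coeff_ne_of_tripleTerm hne
    have := hN _ _ _ _ _ h1 h2 h3
    simp only [e, Equiv.coe_fn_mk, Finset.HasAntidiagonal.mem_antidiagonal] at this hz
    simp only [Set.mem_prod, Set.mem_Icc, Set.mem_Iic]
    omega
  rw [← finsum_comp_equiv e]
  simp only [← hGe]
  rw [finsum_curry _ hfin, coeff_mul]
  refine finsum_congr fun x => ?_
  have hB := finite_mulTerm B C (k - x.1 + x.2)
  have hD : (fun y => derivPow R x.2 (mulTerm B C (k - x.1 + x.2) y)).support.Finite :=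
    hB.subset fun y hy h => hy (by simp [h])
  rw [mulTerm, coeff_mul, map_finsum (derivPow R x.2) hB, mul_finsum' _ _ hD, mul_finsum']
  · exact hD.subset fun y hy h => hy (by simp [h])

protected theorem mul_assoc (A B C : PseudoDiffOp R) : A * B * C = A * (B * C) := by
  ext k
  rw [coeff_mul_mul_left, coeff_mul_mul_right]

protected theorem one_mul (A : PseudoDiffOp R) : 1 * A = A := by
  ext k
  exact (monomial_mul_coeff_zero 1 A k).trans (one_mul _)

noncomputable instance : Ring (PseudoDiffOp R) where
  __ := (inferInstance : AddCommGroup (PseudoDiffOp R))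
  left_distrib := PseudoDiffOp.mul_add
  right_distrib := PseudoDiffOp.add_mul
  zero_mul A := by
    have h := PseudoDiffOp.add_mul 0 0 A
    rwa [add_zero, left_eq_add] at h
  mul_zero A := by
    have h := PseudoDiffOp.mul_add A 0 0
    rwa [add_zero, left_eq_add] at h
  mul_assoc := PseudoDiffOp.mul_assoc
  one_mul := PseudoDiffOp.one_mul
  mul_one := PseudoDiffOp.mul_one

end Mul

section Order

variable {R : Type*} [CommRing R]

/-- `ord A ≤ m` (with `ord 0 = -∞`). -/
def OrderLE (A : PseudoDiffOp R) (m : ℤ) : Prop := ∀ i, m < i → A.coeff i = 0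

/-- `A` is monic of order `m`. -/
def IsMonicOfOrder (A : PseudoDiffOp R) (m : ℤ) : Prop := A.coeff m = 1 ∧ A.OrderLE m

/-- `A` is a differential operator: it has no negative powers of `∂`. -/
def IsDiffOp (A : PseudoDiffOp R) : Prop := ∀ i, i < 0 → A.coeff i = 0

/-- `A = ∂^n + a_{n-2} ∂^{n-2} + ⋯ + a_1 ∂ + a_0`. -/
def IsNormalForm (A : PseudoDiffOp R) (n : ℕ) : Prop :=
  A.IsDiffOp ∧ A.IsMonicOfOrder n ∧ A.coeff ((n : ℤ) - 1) = 0

/-- The positive part `A₊ = ∑_{i ≥ 0} a_i ∂^i`. -/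
def positivePart (A : PseudoDiffOp R) : PseudoDiffOp R :=
  ⟨fun i => if 0 ≤ i then A.coeff i else 0, by
    obtain ⟨N, hN⟩ := A.exists_bound
    exact ⟨N, fun i hi => by simp [hN i hi]⟩⟩

/-- Multiplication of a pseudo-differential operator by a function on the left. -/
instance : SMul R (PseudoDiffOp R) :=
  ⟨fun a A => ⟨fun i => a * A.coeff i, by
    obtain ⟨N, hN⟩ := A.exists_bound
    exact ⟨N, fun i hi => by simp [hN i hi]⟩⟩⟩

theorem coeff_smul (a : R) (A : PseudoDiffOp R) (i : ℤ) : (a • A).coeff i = a * A.coeff i := rfl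

instance : Module R (PseudoDiffOp R) where
  one_smul A := by ext i; simp [coeff_smul]
  mul_smul a b A := by ext i; simp [coeff_smul, mul_assoc]
  smul_zero a := by ext i; simp [coeff_smul, coeff_zero]
  smul_add a A B := by ext i; simp [coeff_smul, coeff_add, mul_add]
  add_smul a b A := by ext i; simp [coeff_smul, coeff_add, add_mul]
  zero_smul A := by ext i; simp [coeff_smul, coeff_zero]

end Order

/-- The monic `n`-th root of a monic pseudo-differential operator of order `n`
(with value `0` if there is none; it exists and is unique for monic operators of order `n ≥ 1`
over a differential domain of characteristic zero in which `n` is invertible). -/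
noncomputable def monicRoot {R : Type*} [CommRing R] [Differential R] (n : ℕ)
    (A : PseudoDiffOp R) : PseudoDiffOp R :=
  open Classical in
  if h : ∃ Q : PseudoDiffOp R, Q.IsMonicOfOrder 1 ∧ Q ^ n = A then h.choose else 0

theorem smul_mul_assoc_of_const {R : Type*} [CommRing R] [Differential R] (a : R)
    (A B : PseudoDiffOp R) : (a • A) * B = a • (A * B) := by
  ext k
  rw [coeff_smul, coeff_mul, coeff_mul, mul_finsum' _ _ (finite_mulTerm A B k)]
  refine finsum_congr fun p => ?_
  simp only [mulTerm, coeff_smul]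
  ring

theorem mul_smul_comm_of_const {R : Type*} [CommRing R] [Differential R] {a : R}
    (ha : Differential.deriv a = 0) (A B : PseudoDiffOp R) : A * (a • B) = a • (A * B) := by
  ext k
  rw [coeff_smul, coeff_mul, coeff_mul, mul_finsum' _ _ (finite_mulTerm A B k)]
  refine finsum_congr fun p => ?_
  simp only [mulTerm, coeff_smul, derivPow_const_mul ha]
  ring

theorem IsDiffOp.mul {R : Type*} [CommRing R] [Differential R] {A B : PseudoDiffOp R}
    (hA : A.IsDiffOp) (hB : B.IsDiffOp) : (A * B).IsDiffOp := by
  intro k hk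
  rw [coeff_mul, ← finsum_zero (α := ℤ × ℕ)]
  refine finsum_congr fun ⟨i, l⟩ => ?_
  by_cases hi : i < 0
  · simp [mulTerm, hA i hi]
  by_cases hl : k - i + l < 0
  · simp [mulTerm, hB _ hl]
  have h : Ring.choose i l = 0 := by
    obtain ⟨j, rfl⟩ := Int.eq_ofNat_of_zero_le (not_lt.mp hi)
    have := Ring.choose_natCast (R := ℤ) j l
    rw [this, Nat.choose_eq_zero_of_lt (by omega), Nat.cast_zero]
  simp [mulTerm, h]

end PseudoDiffOp

/-- The field of constants of a differential field. -/
def constants (K : Type*) [Field K] [Differential K] : Subfield K where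
  carrier := {a | Differential.deriv a = 0}
  mul_mem' {a b} ha hb := by
    simp only [Set.mem_ofPred_eq] at *
    simp [ha, hb]
  one_mem' := by simp
  add_mem' {a b} ha hb := by
    simp only [Set.mem_ofPred_eq] at *
    simp [ha, hb]
  zero_mem' := by simp
  neg_mem' {a} ha := by
    simp only [Set.mem_ofPred_eq] at *
    simp [ha]
  inv_mem' a ha := by
    simp only [Set.mem_ofPred_eq] at *
    rw [Derivation.leibniz_inv]
    simp [ha]

namespace PseudoDiffOp

section Field

variable {K : Type*} [Field K] [Differential K]

noncomputable instance : Algebra (constants K) (PseudoDiffOp K) :=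
  Algebra.ofModule (fun a A B => smul_mul_assoc_of_const (a : K) A B)
    (fun a A B => mul_smul_comm_of_const a.2 A B)

variable (K) in
/-- The ring `K[∂]` of differential operators, as a subalgebra of `K((∂⁻¹))`. -/
noncomputable def diffOps : Subalgebra (constants K) (PseudoDiffOp K) where
  carrier := {A | A.IsDiffOp}
  mul_mem' hA hB := hA.mul hB
  add_mem' {A B} hA hB i hi := by rw [coeff_add, hA i hi, hB i hi, add_zero]
  algebraMap_mem' a i hi := by
    rw [Algebra.algebraMap_eq_smul_one]
    change (a : K) * (1 : PseudoDiffOp K).coeff i = 0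
    rw [coeff_one, if_neg (by omega), mul_zero]

variable (K) in
/-- The pseudo-differential operators of order at most `m`. -/
def orderLE (m : ℤ) : Submodule (constants K) (PseudoDiffOp K) where
  carrier := {A | A.OrderLE m}
  add_mem' {A B} hA hB i hi := by rw [coeff_add, hA i hi, hB i hi, add_zero]
  zero_mem' i _ := rfl
  smul_mem' a A hA i hi := by
    change (a : K) * A.coeff i = 0
    rw [hA i hi, mul_zero]

/-- The space `W(L)` of differential operators almost commuting with `L`, for `L` of order `n`:
those `A` in `K[∂]` with `ord [L, A] ≤ n - 2`. -/
noncomputable def almostCommuting (L : PseudoDiffOp K) (n : ℕ) :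
    Submodule (constants K) (PseudoDiffOp K) where
  carrier := {A | A ∈ diffOps K ∧ L * A - A * L ∈ orderLE K ((n : ℤ) - 2)}
  add_mem' {A B} hA hB := ⟨add_mem hA.1 hB.1, by
    have h := add_mem hA.2 hB.2
    rwa [show L * A - A * L + (L * B - B * L) = L * (A + B) - (A + B) * L by noncomm_ring] at h⟩
  zero_mem' := ⟨zero_mem _, by simp⟩
  smul_mem' a A hA := ⟨Subalgebra.smul_mem _ hA.1 a, by
    rw [mul_smul_comm, smul_mul_assoc, ← smul_sub]
    exact Submodule.smul_mem _ a hA.2⟩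

/-- `W_m(L)`: the almost commuting operators of order at most `m`. -/
noncomputable def almostCommutingLE (L : PseudoDiffOp K) (n m : ℕ) :
    Submodule (constants K) (PseudoDiffOp K) :=
  almostCommuting L n ⊓ orderLE K m

/-- The centralizer `Z(L)` of `L` in `K[∂]`. -/
noncomputable def diffCentralizer (L : PseudoDiffOp K) :
    Subalgebra (constants K) (PseudoDiffOp K) :=
  diffOps K ⊓ Subalgebra.centralizer (constants K) {L}

/-- `Z_m(L) = W_m(L) ∩ Z(L)`. -/
noncomputable def diffCentralizerLE (L : PseudoDiffOp K) (n m : ℕ) :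
    Submodule (constants K) (PseudoDiffOp K) :=
  almostCommutingLE L n m ⊓ Subalgebra.toSubmodule (diffCentralizer L)

/-- `C[L]`: the polynomials in `L` with constant coefficients. -/
noncomputable def constPoly (L : PseudoDiffOp K) : Subalgebra (constants K) (PseudoDiffOp K) :=
  Algebra.adjoin (constants K) {L}

/-- `C_m[L]`: the polynomials in `L` with constant coefficients, of order at most `m`. -/
noncomputable def constPolyLE (L : PseudoDiffOp K) (m : ℕ) :
    Submodule (constants K) (PseudoDiffOp K) :=
  Subalgebra.toSubmodule (constPoly L) ⊓ orderLE K m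

theorem constPoly_le {L : PseudoDiffOp K} (hL : L.IsDiffOp) :
    constPoly L ≤ diffCentralizer L := by
  refine Algebra.adjoin_le (Set.singleton_subset_iff.mpr ⟨hL, ?_⟩)
  intro A hA
  rw [Set.mem_singleton_iff.mp hA]

theorem constPolyLE_le {L : PseudoDiffOp K} (hL : L.IsDiffOp) (n m : ℕ) :
    constPolyLE L m ≤ diffCentralizerLE L n m := by
  rintro A ⟨h1, h2⟩
  have h3 : A ∈ diffCentralizer L := constPoly_le hL h1
  have h4 : L * A = A * L := h3.2 L rfl
  refine ⟨⟨⟨h3.1, ?_⟩, h2⟩, h3⟩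
  rw [h4, sub_self]
  exact zero_mem _

end Field

end PseudoDiffOp

/-! ### The Gelfand-Dickey hierarchy -/

namespace GelfandDickey

open PseudoDiffOp

/-- The ring `C{U}` of differential polynomials over a ring `C` of constants in the
differential variables `U = {u_2, …, u_n}`; the variable `(ℓ, k)` is `u_ℓ^{(k)}`. -/
abbrev DiffPoly (C : Type*) [CommRing C] (n : ℕ) : Type _ :=
  MvPolynomial (↥(Finset.Icc 2 n) × ℕ) C

/-- The derivation of `C{U}`: it vanishes on `C` and sends `u_ℓ^{(k)}` to `u_ℓ^{(k+1)}`. -/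
noncomputable instance (C : Type*) [CommRing C] (n : ℕ) : Differential (DiffPoly C n) :=
  ⟨(MvPolynomial.mkDerivation C
    fun v : ↥(Finset.Icc 2 n) × ℕ => MvPolynomial.X (v.1, v.2 + 1)).restrictScalars ℤ⟩

section Formal

variable (C : Type*) [CommRing C] (n : ℕ)

/-- The formal operator `L_n = ∂^n + u_2 ∂^{n-2} + ⋯ + u_{n-1} ∂ + u_n`. -/
noncomputable def formalOp : PseudoDiffOp (DiffPoly C n) :=
  monomial n 1 + ∑ ℓ : ↥(Finset.Icc 2 n), monomial ((n : ℤ) - (ℓ : ℕ)) (MvPolynomial.X (ℓ, 0))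

/-- The homogeneous basis `P_j = (Q^j)₊`, where `Q = L_n^{1/n}`, of the operators almost
commuting with `L_n`. -/
noncomputable def basisOp (j : ℕ) : PseudoDiffOp (DiffPoly C n) :=
  positivePart (monicRoot n (formalOp C n) ^ j)

/-- The differential polynomial `H_{k,j}`: the coefficient of `∂^k` in `[P_j, L_n]`. -/
noncomputable def H (k j : ℕ) : DiffPoly C n :=
  (basisOp C n j * formalOp C n - formalOp C n * basisOp C n j).coeff k

end Formal

/-- The index set `J_{n,m}` of integers in `{1, …, m}` not divisible by `n`. -/
def J (n m : ℕ) : Finset ℕ := (Finset.Icc 1 m).filter fun j => ¬ n ∣ j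

section Specialization

variable {K : Type*} [Field K] [Differential K] (L : PseudoDiffOp K) (n : ℕ)

/-- The specialization `C{U} → K` at the coefficients of
`L = ∂^n + υ_2 ∂^{n-2} + ⋯ + υ_n`: it sends `u_ℓ^{(k)}` to `∂^k (υ_ℓ)`. -/
noncomputable def specialize : DiffPoly (constants K) n →ₐ[constants K] K :=
  MvPolynomial.aeval fun v => derivPow K v.2 (L.coeff ((n : ℤ) - (v.1 : ℕ)))

/-- The specialized differential polynomials `σ_{k,j}`. -/
noncomputable def sigma (k j : ℕ) : K := specialize L n (H (constants K) n k j)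

/-- `c` is a solution in `K` of the homogeneous system
`hGD_{n,m}(L) : ∑_{j ∈ J_{n,m}} c_j σ_{k,j} = 0`, `k = 0, …, n - 2`. -/
def IsSolution (m : ℕ) (c : J n m → K) : Prop :=
  ∀ k : ℕ, k + 2 ≤ n → ∑ j : J n m, c j * sigma L n k j = 0

/-- The space `V_m` of constant solutions of `hGD_{n,m}(L)`. -/
def constSolutions (m : ℕ) : Submodule (constants K) (J n m → constants K) where
  carrier := {ξ | IsSolution L n m fun j => (ξ j : K)}
  add_mem' {a b} ha hb k hk := by
    have h := congrArg₂ (· + ·) (ha k hk) (hb k hk)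
    rw [← Finset.sum_add_distrib, add_zero] at h
    rw [← h]
    exact Finset.sum_congr rfl fun j _ => add_mul (a j : K) (b j) _
  zero_mem' k _ := by simp
  smul_mem' a b hb k hk := by
    have h := congrArg ((a : K) * ·) (hb k hk)
    rw [Finset.mul_sum, mul_zero] at h
    rw [← h]
    exact Finset.sum_congr rfl fun j _ => mul_assoc (a : K) (b j) _

end Specialization

end GelfandDickey

/-! Over `K((∂⁻¹))` the operator `L` has a monic `n`-th root `Q`. Each `Q ^ j` commutes with `L`, so
the commutator of `L` with the positive part `P_j` of `Q ^ j` comes only from the discarded tail of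
order at most `-1`; it has order at most `n - 2` (`positivePart_pow_mem_almostCommuting`).
Conversely, the leading coefficient of an almost commuting operator is constant, so subtracting
multiples of the `P_j` lowers its order until nothing is left (`exists_eq_sum_positivePart`). Hence
the `P_j` with `j ≤ m` form a basis of `W_m(L)`.

If `n ∣ j`, then `P_j` is a power of `L`; these indices span `C_m[L]`, and `J n m` indexes a
complement. A combination `∑ ξ_j P_j` over `J n m` commutes with `L` exactly when the coefficients
of `∂^0, …, ∂^(n-2)` in its commutator vanish, the others being zero anyway; these are the equations
of the linear system (`combination_mem_diffCentralizerLE_iff`). As `C_m[L]` lies in `Z_m(L)`, this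
gives `Z_m(L) = C_m[L] ⊕ V_m`.

For the second claim, each centralizing operator lies in some `Z_m(L)` with `V_m = 0`.

The root is built over `C{U}` by successive approximation and then specialized coefficientwise. Its
uniqueness is not needed. -/

namespace PseudoDiffOp

/-! ### Orders and the two top coefficients of products and commutators -/

section OrderCalculus

variable {R : Type*} [CommRing R]

theorem OrderLE.mono {A : PseudoDiffOp R} {a b : ℤ} (hA : A.OrderLE a) (h : a ≤ b) :
    A.OrderLE b := fun i hi => hA i (by omega)

theorem OrderLE.add {A B : PseudoDiffOp R} {a : ℤ} (hA : A.OrderLE a) (hB : B.OrderLE a) :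
    (A + B).OrderLE a := fun i hi => by rw [coeff_add, hA i hi, hB i hi, add_zero]

theorem coeff_sub (A B : PseudoDiffOp R) (i : ℤ) :
    (A - B).coeff i = A.coeff i - B.coeff i := by
  rw [sub_eq_add_neg, coeff_add, coeff_neg, sub_eq_add_neg]

theorem OrderLE.sub {A B : PseudoDiffOp R} {a : ℤ} (hA : A.OrderLE a) (hB : B.OrderLE a) :
    (A - B).OrderLE a := fun i hi => by rw [coeff_sub, hA i hi, hB i hi, sub_zero]

theorem OrderLE.of_coeff_eq_zero {A : PseudoDiffOp R} {a : ℤ} (hA : A.OrderLE a)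
    (h : A.coeff a = 0) : A.OrderLE (a - 1) := fun i hi => by
  rcases eq_or_ne i a with rfl | hne
  · exact h
  · exact hA i (by omega)

theorem orderLE_monomial (j : ℤ) (a : R) : (monomial j a).OrderLE j :=
  fun i hi => by rw [coeff_monomial, if_neg (by omega)]

/-- Coefficients as an additive homomorphism. -/
def coeffHom (i : ℤ) : PseudoDiffOp R →+ R where
  toFun A := A.coeff i
  map_zero' := rfl
  map_add' A B := coeff_add A B i

theorem coeff_sum {ι : Type*} (s : Finset ι) (f : ι → PseudoDiffOp R) (i : ℤ) :
    (∑ j ∈ s, f j).coeff i = ∑ j ∈ s, (f j).coeff i := map_sum (coeffHom i) f s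

theorem isMonicOfOrder_one : (1 : PseudoDiffOp R).IsMonicOfOrder 0 :=
  ⟨by simp [coeff_one], fun i hi => by rw [coeff_one, if_neg (by omega)]⟩

variable [Differential R]

theorem mulTerm_eq_zero_of_orderLE {A B : PseudoDiffOp R} {a b : ℤ} (hA : A.OrderLE a)
    (hB : B.OrderLE b) {k : ℤ} {p : ℤ × ℕ} (h : a < p.1 ∨ b < k - p.1 + p.2) :
    mulTerm A B k p = 0 := by
  rcases h with h | h
  · simp [mulTerm, hA _ h]
  · simp [mulTerm, hB _ h]

theorem OrderLE.mul {A B : PseudoDiffOp R} {a b : ℤ} (hA : A.OrderLE a) (hB : B.OrderLE b) :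
    (A * B).OrderLE (a + b) := by
  intro k hk
  rw [coeff_mul, ← finsum_zero (α := ℤ × ℕ)]
  exact finsum_congr fun p => mulTerm_eq_zero_of_orderLE hA hB (by omega)

theorem coeff_mul_top {A B : PseudoDiffOp R} {a b : ℤ} (hA : A.OrderLE a) (hB : B.OrderLE b) :
    (A * B).coeff (a + b) = A.coeff a * B.coeff b := by
  rw [coeff_mul, finsum_eq_single _ ((a, 0) : ℤ × ℕ)]
  · simp [mulTerm, derivPow_zero]
  · rintro ⟨i, l⟩ h
    refine mulTerm_eq_zero_of_orderLE hA hB ?_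
    by_contra! hc
    simp only at hc
    exact h (by simp only [Prod.mk.injEq]; omega)

/-- Only the index pairs `(a, 0)`, `(a - 1, 0)` and `(a, 1)` contribute; the last one is the first
Leibniz correction, where the derivative comes from. -/
theorem coeff_mul_top_sub_one {A B : PseudoDiffOp R} {a b : ℤ} (hA : A.OrderLE a)
    (hB : B.OrderLE b) :
    (A * B).coeff (a + b - 1) = A.coeff a * B.coeff (b - 1) + A.coeff (a - 1) * B.coeff b +
      a * (A.coeff a * Differential.deriv (B.coeff b)) := by
  classical
  rw [coeff_mul, finsum_eq_sum_of_support_subset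
    (s := ({(a, 0), (a - 1, 0), (a, 1)} : Finset (ℤ × ℕ)))]
  · rw [Finset.sum_insert (by simp; omega), Finset.sum_insert (by simp), Finset.sum_singleton]
    have e1 : a + b - 1 - a = b - 1 := by ring
    have e2 : a + b - 1 - (a - 1) = b := by ring
    simp [mulTerm, derivPow_zero, derivPow_succ, e1, e2, add_assoc]
  · rintro ⟨i, l⟩ h
    by_contra hc
    refine h (mulTerm_eq_zero_of_orderLE hA hB ?_)
    by_contra! hlt
    simp only [Finset.coe_insert, Finset.coe_singleton, Set.mem_insert_iff,
      Set.mem_singleton_iff, Prod.mk.injEq] at hc hlt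
    omega

/-- The coefficients commute, so the top terms of the two products cancel. -/
theorem OrderLE.commutator {A B : PseudoDiffOp R} {a b : ℤ} (hA : A.OrderLE a)
    (hB : B.OrderLE b) : (A * B - B * A).OrderLE (a + b - 1) := by
  refine ((hA.mul hB).sub (((hB.mul hA)).mono (add_comm b a).le)).of_coeff_eq_zero ?_
  rw [coeff_sub, coeff_mul_top hA hB, add_comm a b, coeff_mul_top hB hA, mul_comm, sub_self]

/-- The underived terms cancel by commutativity. For monic `A` what remains is `a` times the
derivative of the leading coefficient of `B`. -/
theorem coeff_commutator {A B : PseudoDiffOp R} {a b : ℤ} (hA : A.OrderLE a)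
    (hB : B.OrderLE b) :
    (A * B - B * A).coeff (a + b - 1) = a * (A.coeff a * Differential.deriv (B.coeff b)) -
      b * (B.coeff b * Differential.deriv (A.coeff a)) := by
  rw [coeff_sub, coeff_mul_top_sub_one hA hB, add_comm a b, coeff_mul_top_sub_one hB hA]
  ring

theorem IsMonicOfOrder.mul {A B : PseudoDiffOp R} {a b : ℤ} (hA : A.IsMonicOfOrder a)
    (hB : B.IsMonicOfOrder b) : (A * B).IsMonicOfOrder (a + b) :=
  ⟨by rw [coeff_mul_top hA.2 hB.2, hA.1, hB.1, mul_one], hA.2.mul hB.2⟩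

theorem IsMonicOfOrder.pow {A : PseudoDiffOp R} {a : ℤ} (hA : A.IsMonicOfOrder a) (n : ℕ) :
    (A ^ n).IsMonicOfOrder (n * a) := by
  induction n with
  | zero => simpa using isMonicOfOrder_one
  | succ n ih =>
    rw [pow_succ, show ((n + 1 : ℕ) : ℤ) * a = n * a + a by push_cast; ring]
    exact ih.mul hA

end OrderCalculus

/-! ### Existence of monic `n`-th roots -/

section Root

variable {R : Type*} [CommRing R] [Differential R]

/-- The first-order expansion `n A^(n-1) E`, valid at top order. Since `e ≤ 0`, the perturbation
leaves `A + E` monic of order `1`. -/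
theorem pow_add_sub_pow {A E : PseudoDiffOp R} (hA : A.IsMonicOfOrder 1) {e : ℤ} (he : e ≤ 0)
    (hE : E.OrderLE e) (n : ℕ) :
    ((A + E) ^ n - A ^ n).OrderLE (n - 1 + e) ∧
      ((A + E) ^ n - A ^ n).coeff (n - 1 + e) = n * E.coeff e := by
  induction n with
  | zero => simp [OrderLE, coeff_zero]
  | succ n ih =>
    have hsplit : (A + E) ^ (n + 1) - A ^ (n + 1) =
        ((A + E) ^ n - A ^ n) * (A + E) + A ^ n * E := by
      rw [pow_succ, pow_succ]; noncomm_ring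
    have hAn : (A ^ n).IsMonicOfOrder n := by simpa using hA.pow n
    have hAE : (A + E).OrderLE 1 := hA.2.add (hE.mono (by omega))
    have e1 : ((n + 1 : ℕ) : ℤ) - 1 + e = (n - 1 + e) + 1 := by push_cast; ring
    have e2 : (n : ℤ) - 1 + e + 1 = n + e := by ring
    rw [hsplit, e1]
    refine ⟨(ih.1.mul hAE).add (e2 ▸ hAn.2.mul hE), ?_⟩
    rw [coeff_add, coeff_mul_top ih.1 hAE, e2, coeff_mul_top hAn.2 hE, hAn.1, ih.2, coeff_add,
      hA.1]
    rcases he.lt_or_eq with h | rfl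
    · rw [hE 1 (by omega)]; push_cast; ring
    · rw [hE 1 (by omega)]; push_cast; ring

/-- Successive approximations `∂ + q_0 + ⋯ + q_{1-k} ∂^{1-k}` of the monic `n`-th root of `A`,
where `c` is an inverse of `n`. -/
noncomputable def rootApprox (A : PseudoDiffOp R) (n : ℕ) (c : R) : ℕ → PseudoDiffOp R
  | 0 => monomial 1 1
  | k + 1 => rootApprox A n c k +
      monomial (-(k : ℤ)) (c * (A - rootApprox A n c k ^ n).coeff (n - 1 - k))

variable (A : PseudoDiffOp R) (n : ℕ) (c : R)

/-- Later corrections only touch orders `≤ -k`, so every coefficient is eventually stationary. -/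
theorem rootApprox_sub (k : ℕ) (i : ℕ) :
    (rootApprox A n c (k + i) - rootApprox A n c k).OrderLE (-(k : ℤ)) := by
  induction i with
  | zero => intro j _; simp [coeff_zero]
  | succ i ih =>
    rw [← add_assoc, rootApprox, add_sub_right_comm]
    exact ih.add ((orderLE_monomial _ _).mono (by push_cast; omega))

theorem isMonicOfOrder_rootApprox (k : ℕ) : (rootApprox A n c k).IsMonicOfOrder 1 := by
  induction k with
  | zero => exact ⟨by simp [rootApprox, coeff_monomial], orderLE_monomial _ _⟩
  | succ k ih =>
    refine ⟨?_, ih.2.add ((orderLE_monomial _ _).mono (by omega))⟩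
    rw [rootApprox, coeff_add, ih.1, coeff_monomial, if_neg (by omega), add_zero]

variable {A n c}

/-- A correction `q ∂^(-k)` changes the `n`-th power by `n q` at order `n - 1 - k`; taking `q` to be
`c = 1/n` times the defect there cancels it. -/
theorem orderLE_sub_rootApprox_pow (hA : A.IsMonicOfOrder n) (hc : n * c = 1) (k : ℕ) :
    (A - rootApprox A n c k ^ n).OrderLE (n - 1 - k) := by
  induction k with
  | zero =>
    have h := (isMonicOfOrder_rootApprox A n c 0).pow n
    rw [mul_one] at h
    rw [Nat.cast_zero, sub_zero]
    refine (hA.2.sub h.2).of_coeff_eq_zero ?_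
    rw [coeff_sub, hA.1, h.1, sub_self]
  | succ k ih =>
    set Q := rootApprox A n c k with hQ
    have h := pow_add_sub_pow (isMonicOfOrder_rootApprox A n c k) (e := -(k : ℤ)) (by omega)
      (orderLE_monomial _ (c * (A - Q ^ n).coeff (n - 1 - k))) n
    rw [← hQ, ← sub_eq_add_neg] at h
    have hs : A - rootApprox A n c (k + 1) ^ n = (A - Q ^ n) -
        ((Q + monomial (-(k : ℤ)) (c * (A - Q ^ n).coeff (n - 1 - k))) ^ n - Q ^ n) := by
      rw [rootApprox, ← hQ]; abel
    rw [hs, Nat.cast_succ, ← sub_sub]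
    refine (ih.sub h.1).of_coeff_eq_zero ?_
    rw [coeff_sub _ (_ - _), h.2, coeff_monomial, if_pos rfl, ← mul_assoc, hc, one_mul, sub_self]

theorem exists_monicRoot (hA : A.IsMonicOfOrder n) (hc : n * c = 1) :
    ∃ Q : PseudoDiffOp R, Q.IsMonicOfOrder 1 ∧ Q ^ n = A := by
  have hmon := isMonicOfOrder_rootApprox A n c
  let Q : PseudoDiffOp R :=
    -- The coefficient of `∂^i` no longer changes from approximation `1 - i` on.
    ⟨fun i => (rootApprox A n c (1 - i).toNat).coeff i, 1, fun i hi => (hmon _).2 i hi⟩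
  have hQ : ∀ k : ℕ, (Q - rootApprox A n c k).OrderLE (-(k : ℤ)) := by
    intro k i hi
    rw [coeff_sub, sub_eq_zero]
    change (rootApprox A n c (1 - i).toNat).coeff i = _
    rcases le_total k (1 - i).toNat with h | h
    · obtain ⟨d, hd⟩ := Nat.exists_eq_add_of_le h
      rw [hd, ← sub_eq_zero, ← coeff_sub]
      exact rootApprox_sub A n c k d i hi
    · obtain ⟨d, hd⟩ := Nat.exists_eq_add_of_le h
      rw [hd, eq_comm, ← sub_eq_zero, ← coeff_sub]
      exact rootApprox_sub A n c _ d i (by omega)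
  refine ⟨Q, ⟨(hmon (1 - 1 : ℤ).toNat).1, fun i hi => (hmon _).2 i hi⟩, ?_⟩
  have key : ∀ k : ℕ, (A - Q ^ n).OrderLE (n - 1 - k) := by
    intro k
    have h := (pow_add_sub_pow (hmon k) (by omega) (hQ k) n).1
    rw [add_sub_cancel, ← sub_eq_add_neg] at h
    rw [show A - Q ^ n = (A - rootApprox A n c k ^ n) - (Q ^ n - rootApprox A n c k ^ n) by abel]
    exact (orderLE_sub_rootApprox_pow hA hc k).sub h
  ext i
  -- This `k` satisfies `n - 1 - k < i`, so the defect vanishes at `i`.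
  have := key (n - i).toNat i (by omega)
  rw [coeff_sub, sub_eq_zero] at this
  exact this.symm

theorem monicRoot_spec (hA : A.IsMonicOfOrder n) (hc : n * c = 1) :
    (monicRoot n A).IsMonicOfOrder 1 ∧ monicRoot n A ^ n = A := by
  have h := exists_monicRoot hA hc
  rw [monicRoot, dif_pos h]
  exact h.choose_spec

end Root

/-! ### Change of differential coefficient ring -/

section Map

variable {R S : Type*} [CommRing R] [Differential R] [CommRing S] [Differential S]

theorem map_derivPow (f : R →+* S)
    (hf : ∀ a, f (Differential.deriv a) = Differential.deriv (f a)) (l : ℕ) (a : R) :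
    f (derivPow R l a) = derivPow S l (f a) := by
  induction l with
  | zero => rfl
  | succ l ih => rw [derivPow_succ, derivPow_succ, hf, ih]

/-- The homomorphism of pseudo-differential operators induced by a homomorphism of
differential rings, acting coefficientwise. -/
noncomputable def map (f : R →+* S)
    (hf : ∀ a, f (Differential.deriv a) = Differential.deriv (f a)) :
    PseudoDiffOp R →+* PseudoDiffOp S where
  toFun A := ⟨fun i => f (A.coeff i), by
    obtain ⟨N, hN⟩ := A.exists_bound
    exact ⟨N, fun i hi => by rw [hN i hi, map_zero]⟩⟩
  map_one' := by
    ext i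
    simp only [coeff_one, apply_ite f, map_one, map_zero]
  map_zero' := by
    ext i
    simp only [coeff_zero, map_zero]
  map_add' A B := by
    ext i
    simp only [coeff_add, map_add]
  map_mul' A B := by
    ext k
    rw [coeff_mul]
    refine (f.toAddMonoidHom.map_finsum (finite_mulTerm A B k)).trans (finsum_congr fun p => ?_)
    simp [mulTerm, map_derivPow f hf]

variable (f : R →+* S) (hf : ∀ a, f (Differential.deriv a) = Differential.deriv (f a))

theorem coeff_map (A : PseudoDiffOp R) (i : ℤ) : (map f hf A).coeff i = f (A.coeff i) := rfl

theorem IsMonicOfOrder.map {A : PseudoDiffOp R} {a : ℤ} (hA : A.IsMonicOfOrder a) :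
    (A.map f hf).IsMonicOfOrder a :=
  ⟨by rw [coeff_map, hA.1, map_one], fun i hi => by rw [coeff_map, hA.2 i hi, map_zero]⟩

theorem map_positivePart (A : PseudoDiffOp R) :
    map f hf A.positivePart = (map f hf A).positivePart := by
  ext i
  simp only [coeff_map, positivePart, apply_ite f, map_zero]

end Map

/-! ### Positive parts -/

section PositivePart

variable {R : Type*} [CommRing R]

theorem coeff_positivePart (A : PseudoDiffOp R) {i : ℤ} (hi : 0 ≤ i) :
    A.positivePart.coeff i = A.coeff i := if_pos hi

theorem isDiffOp_positivePart (A : PseudoDiffOp R) : A.positivePart.IsDiffOp :=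
  fun _ hi => if_neg (by omega)

theorem IsDiffOp.positivePart_eq {A : PseudoDiffOp R} (hA : A.IsDiffOp) : A.positivePart = A := by
  ext i
  by_cases hi : 0 ≤ i
  · exact coeff_positivePart A hi
  · exact (if_neg hi).trans (hA i (by omega)).symm

theorem orderLE_sub_positivePart (A : PseudoDiffOp R) : (A - A.positivePart).OrderLE (-1) :=
  fun i hi => by
    rw [coeff_sub, coeff_positivePart A (by omega), sub_self]

theorem IsMonicOfOrder.positivePart {A : PseudoDiffOp R} {a : ℕ} (hA : A.IsMonicOfOrder a) :
    A.positivePart.IsMonicOfOrder a :=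
  ⟨(coeff_positivePart A (by omega)).trans hA.1, fun i hi =>
    (coeff_positivePart A (by omega)).trans (hA.2 i hi)⟩

theorem IsDiffOp.eq_zero {A : PseudoDiffOp R} (hA : A.IsDiffOp) (h : A.OrderLE (-1)) : A = 0 := by
  ext i
  by_cases hi : i < 0
  · exact hA i hi
  · exact h i (by omega)

end PositivePart

/-! ### A basis of the operators almost commuting with `L` -/

section AlmostCommuting

variable {K : Type*} [Field K] [Differential K]

theorem coeff_const_smul (c : constants K) (A : PseudoDiffOp K) (i : ℤ) :
    (c • A).coeff i = (c : K) * A.coeff i := rfl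

theorem mem_diffCentralizer {L A : PseudoDiffOp K} :
    A ∈ L.diffCentralizer ↔ A.IsDiffOp ∧ L * A = A * L :=
  ⟨fun h => ⟨h.1, h.2 L rfl⟩, fun h => ⟨h.1, fun B hB => by
    rw [Set.mem_singleton_iff.mp hB]; exact h.2⟩⟩

/-- Operators `P j` that are monic of order `j` are linearly independent over the constants. -/
theorem linearIndependent_of_isMonicOfOrder {P : ℕ → PseudoDiffOp K}
    (hP : ∀ j, (P j).IsMonicOfOrder j) : LinearIndependent (constants K) P := by
  rw [linearIndependent_iff']
  intro s
  -- At the largest index `a`, the coefficient of `∂^a` sees only the term of index `a`.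
  induction s using Finset.induction_on_max with
  | empty => simp
  | insert a s hs ih =>
    intro g hg
    have has : a ∉ s := fun h => lt_irrefl _ (hs a h)
    rw [Finset.sum_insert has] at hg
    have hga : g a = 0 := by
      have h := congrArg (fun A => coeff A a) hg
      simp only [coeff_add, coeff_sum, coeff_const_smul, coeff_zero, (hP a).1, mul_one] at h
      rw [Finset.sum_eq_zero fun j hj => by
        rw [(hP j).2 a (by exact_mod_cast hs j hj), mul_zero], add_zero] at h
      exact_mod_cast h
    rw [hga, zero_smul, zero_add] at hg
    simpa [hga] using ih g hg

variable {n : ℕ} {L Q : PseudoDiffOp K}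

theorem isMonicOfOrder_positivePart_pow (hQ : Q.IsMonicOfOrder 1) (j : ℕ) :
    (Q ^ j).positivePart.IsMonicOfOrder j := by
  have h := hQ.pow j
  rw [mul_one] at h
  exact h.positivePart

theorem positivePart_pow_mul (hL : L.IsDiffOp) (hQL : Q ^ n = L) (k : ℕ) :
    (Q ^ (n * k)).positivePart = L ^ k := by
  rw [pow_mul, hQL]
  exact IsDiffOp.positivePart_eq (pow_mem (S := diffOps K) hL k)

/-- Since `Q ^ j` commutes with `L`, the commutator equals, up to sign, that of the tail of order `≤
-1`, whose order is at most `-1 + n - 1`. -/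
theorem positivePart_pow_mem_almostCommuting (hL : L.OrderLE n) (hQL : Q ^ n = L) (j : ℕ) :
    (Q ^ j).positivePart ∈ almostCommuting L n := by
  refine ⟨isDiffOp_positivePart _, ?_⟩
  have hc : L * Q ^ j = Q ^ j * L := by rw [← hQL, ← pow_add, ← pow_add, add_comm]
  have h := (orderLE_sub_positivePart (Q ^ j)).commutator hL
  rw [show (Q ^ j - (Q ^ j).positivePart) * L - L * (Q ^ j - (Q ^ j).positivePart) =
    L * (Q ^ j).positivePart - (Q ^ j).positivePart * L by
      rw [sub_mul, mul_sub, hc]; abel] at h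
  exact h.mono (by omega)

/-- The coefficient of `∂^(n+m-1)` in `[L, A]` is `n` times the derivative of `A.coeff m`, and it
vanishes because `n + m - 1 > n - 2`. -/
theorem mem_constants_of_almostCommuting [CharZero K] (hn : n ≠ 0) (hL : L.IsMonicOfOrder n)
    {A : PseudoDiffOp K} (hA : A ∈ almostCommuting L n) {m : ℕ} (hm : A.OrderLE m) :
    A.coeff m ∈ constants K := by
  have h := coeff_commutator hL.2 hm
  rw [hA.2 _ (by omega), hL.1] at h
  have h' : (n : K) * Differential.deriv (A.coeff m) = 0 := by simpa using h.symm
  exact (mul_eq_zero.mp h').resolve_left (Nat.cast_ne_zero.mpr hn)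

/-- The positive parts of the powers of an `n`-th root of `L` span the operators almost
commuting with `L`. -/
theorem exists_eq_sum_positivePart [CharZero K] (hn : n ≠ 0) (hL : L.IsMonicOfOrder n)
    (hQ : Q.IsMonicOfOrder 1) (hQL : Q ^ n = L) (m : ℕ) :
    ∀ A ∈ almostCommuting L n, A.OrderLE ((m : ℤ) - 1) → ∃ c : ℕ → constants K,
      A = ∑ j ∈ Finset.range m, c j • (Q ^ j).positivePart := by
  induction m with
  | zero =>
    intro A hA hm
    exact ⟨0, IsDiffOp.eq_zero hA.1 (hm.mono (by omega))⟩
  | succ m ih =>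
    intro A hA hm
    have hm' : A.OrderLE m := hm.mono (by push_cast; omega)
    set a : constants K := ⟨A.coeff m, mem_constants_of_almostCommuting hn hL hA hm'⟩ with ha
    have hP := isMonicOfOrder_positivePart_pow hQ m
    have hPm : (a • (Q ^ m).positivePart).OrderLE m := fun i hi => by
      rw [coeff_const_smul, hP.2 i hi, mul_zero]
    -- Constancy of `a` keeps the difference almost commuting, while the leading term cancels.
    obtain ⟨c, hc⟩ := ih (A - a • (Q ^ m).positivePart)
      (sub_mem hA (Submodule.smul_mem _ a (positivePart_pow_mem_almostCommuting hL.2 hQL m)))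
      ((hm'.sub hPm).of_coeff_eq_zero (by
        rw [coeff_sub, coeff_const_smul, hP.1, mul_one, sub_self]))
    refine ⟨Function.update c m a, ?_⟩
    rw [Finset.sum_range_succ, Function.update_self, ← sub_eq_iff_eq_add, hc]
    refine Finset.sum_congr rfl fun j hj => ?_
    rw [Function.update_of_ne (Finset.mem_range.mp hj).ne]

end AlmostCommuting

end PseudoDiffOp

/-! ### The formal operator and its specialization -/

namespace GelfandDickey

open PseudoDiffOp

theorem coeff_formalOp (C : Type*) [CommRing C] (n : ℕ) (i : ℤ) :
    (formalOp C n).coeff i = (if i = n then 1 else 0) +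
      ∑ ℓ : ↥(Finset.Icc 2 n), if i = (n : ℤ) - (ℓ : ℕ) then MvPolynomial.X (ℓ, 0) else 0 := by
  rw [formalOp, coeff_add, coeff_sum]
  rfl

theorem isMonicOfOrder_formalOp (C : Type*) [CommRing C] (n : ℕ) :
    (formalOp C n).IsMonicOfOrder n := by
  have h : ∀ i : ℤ, n ≤ i → ∑ ℓ : ↥(Finset.Icc 2 n),
      (if i = (n : ℤ) - (ℓ : ℕ) then (MvPolynomial.X (ℓ, 0) : DiffPoly C n) else 0) = 0 :=
    fun i hi => Finset.sum_eq_zero fun ℓ _ => if_neg (by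
      have := (Finset.mem_Icc.mp ℓ.2).1
      omega)
  refine ⟨?_, fun i hi => ?_⟩
  · rw [coeff_formalOp, h _ le_rfl, if_pos rfl, add_zero]
  · rw [coeff_formalOp, h _ hi.le, if_neg hi.ne', add_zero]

section Specialization

variable {K : Type*} [Field K] [Differential K] (L : PseudoDiffOp K) (n : ℕ)

theorem deriv_C (C : Type*) [CommRing C] (c : C) :
    Differential.deriv (MvPolynomial.C c : DiffPoly C n) = 0 :=
  (MvPolynomial.mkDerivation C _).map_algebraMap c

theorem deriv_X (C : Type*) [CommRing C] (v : ↥(Finset.Icc 2 n) × ℕ) :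
    Differential.deriv (MvPolynomial.X v : DiffPoly C n) = MvPolynomial.X (v.1, v.2 + 1) :=
  MvPolynomial.mkDerivation_X C _ v

/-- It suffices to check constants and the variables `u_ℓ^{(k)}`; the Leibniz rule propagates the
identity to products. -/
theorem specialize_deriv (p : DiffPoly (constants K) n) :
    specialize L n (Differential.deriv p) = Differential.deriv (specialize L n p) := by
  induction p using MvPolynomial.induction_on with
  | C a =>
    rw [deriv_C, map_zero, specialize, MvPolynomial.aeval_C]
    exact a.2.symm
  | add p q hp hq => simp only [map_add, hp, hq]
  | mul_X p v hp =>
    have hX : specialize L n (Differential.deriv (MvPolynomial.X v)) =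
        Differential.deriv (specialize L n (MvPolynomial.X v)) := by
      rw [deriv_X, specialize, MvPolynomial.aeval_X, MvPolynomial.aeval_X, derivPow_succ]
    simp only [Derivation.leibniz, map_mul, map_add, smul_eq_mul, hp, hX]

/-- The specialization of pseudo-differential operators over `C{U}` at the coefficients of `L`. -/
noncomputable def specializeOp :
    PseudoDiffOp (DiffPoly (constants K) n) →+* PseudoDiffOp K :=
  PseudoDiffOp.map (specialize L n : DiffPoly (constants K) n →+* K) (specialize_deriv L n)

theorem coeff_specializeOp (A : PseudoDiffOp (DiffPoly (constants K) n)) (i : ℤ) :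
    (specializeOp L n A).coeff i = specialize L n (A.coeff i) := rfl

variable {L n}

theorem specializeOp_formalOp (hL : L.IsNormalForm n) :
    specializeOp L n (formalOp (constants K) n) = L := by
  obtain ⟨h0, h1, h2⟩ := hL
  ext i
  have hmon := isMonicOfOrder_formalOp (constants K) n
  rw [coeff_specializeOp]
  rcases lt_trichotomy i n with hi | rfl | hi
  · rw [coeff_formalOp, if_neg hi.ne, zero_add]
    by_cases hℓ : (n - i).toNat ∈ Finset.Icc 2 n
    · have := Finset.mem_Icc.mp hℓ
      rw [Finset.sum_eq_single ⟨_, hℓ⟩, if_pos (by simp only; omega), specialize,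
        MvPolynomial.aeval_X, derivPow_zero]
      · exact congrArg L.coeff (by simp only; omega)
      · exact fun ℓ _ hne => if_neg fun h => hne (Subtype.ext (by simp only; omega))
      · exact fun h => absurd (Finset.mem_univ _) h
    · rw [Finset.sum_eq_zero, map_zero]
      -- Below `n`, the orders carrying no variable are the negative ones and `n - 1`, precisely
      -- where normal form forces a zero.
      · rw [Finset.mem_Icc] at hℓ
        by_cases hneg : i < 0
        · exact (h0 i hneg).symm
        · rw [show i = n - 1 by omega, h2]
      · rintro ⟨ℓ, hl⟩ -
        refine if_neg fun h => hℓ ?_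
        rwa [show (n - i).toNat = ℓ by simp only at h; omega]
  · rw [hmon.1, map_one, h1.1]
  · rw [hmon.2 i hi, map_zero, h1.2 i hi]

theorem monicRoot_formalOp_spec [CharZero K] (hn : n ≠ 0) :
    (monicRoot n (formalOp (constants K) n)).IsMonicOfOrder 1 ∧
      monicRoot n (formalOp (constants K) n) ^ n = formalOp (constants K) n := by
  refine monicRoot_spec (c := MvPolynomial.C (n : constants K)⁻¹)
    (isMonicOfOrder_formalOp _ n) ?_
  have : (n : constants K) ≠ 0 := fun h => hn (by
    have := congrArg (Subtype.val) h
    simpa using this)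
  rw [← map_natCast (MvPolynomial.C (R := constants K)), ← map_mul, mul_inv_cancel₀ this, map_one]

/-- A normal form operator `L` has an `n`-th root `Q` such that `σ_{k,j}` is the coefficient of
`∂^k` in `[(Q^j)₊, L]`. -/
theorem exists_root_sigma [CharZero K] (hn : n ≠ 0) (hL : L.IsNormalForm n) :
    ∃ Q : PseudoDiffOp K, Q.IsMonicOfOrder 1 ∧ Q ^ n = L ∧ ∀ k j : ℕ,
      sigma L n k j = ((Q ^ j).positivePart * L - L * (Q ^ j).positivePart).coeff k := by
  obtain ⟨h1, h2⟩ := monicRoot_formalOp_spec (K := K) hn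
  have h3 := specializeOp_formalOp hL
  -- Specializing the very root that defines `σ` avoids comparing two roots of `L`.
  refine ⟨specializeOp L n (monicRoot n (formalOp (constants K) n)), h1.map _ _, ?_, ?_⟩
  · rw [← map_pow, h2, h3]
  · intro k j
    have hP : specializeOp L n (basisOp (constants K) n j) =
        (specializeOp L n (monicRoot n (formalOp (constants K) n)) ^ j).positivePart := by
      rw [← map_pow]
      exact map_positivePart _ _ _
    have : sigma L n k j = (specializeOp L n (basisOp (constants K) n j *
      formalOp (constants K) n - formalOp (constants K) n * basisOp (constants K) n j)).coeff k :=
      rfl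
    rw [this, map_sub, map_mul, map_mul, h3, hP]

end Specialization

/-! ### Constant solutions and the centralizer -/

section Solutions

variable {K : Type*} [Field K] [Differential K] {L Q : PseudoDiffOp K} {n : ℕ}

variable (Q n) in
/-- The operator `∑_{j ∈ J_{n,m}} ξ_j (Q^j)₊`. -/
noncomputable def combination (m : ℕ) : (J n m → constants K) →ₗ[constants K] PseudoDiffOp K :=
  Fintype.linearCombination (constants K) fun j : J n m => (Q ^ (j : ℕ)).positivePart

theorem combination_apply {m : ℕ} (ξ : J n m → constants K) :
    combination Q n m ξ = ∑ j, ξ j • (Q ^ (j : ℕ)).positivePart :=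
  Fintype.linearCombination_apply _ _ _

theorem combination_mem_almostCommutingLE (hL : L.OrderLE n) (hQ : Q.IsMonicOfOrder 1)
    (hQL : Q ^ n = L) {m : ℕ} (ξ : J n m → constants K) :
    combination Q n m ξ ∈ almostCommutingLE L n m := by
  rw [combination_apply]
  refine sum_mem fun j _ => Submodule.smul_mem _ _
    ⟨positivePart_pow_mem_almostCommuting hL hQL j, ?_⟩
  refine (isMonicOfOrder_positivePart_pow hQ j).2.mono ?_
  have := (Finset.mem_Icc.mp (Finset.mem_filter.mp j.2).1).2
  omega

theorem coeff_commutator_combination (hσ : ∀ k j : ℕ,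
    sigma L n k j = ((Q ^ j).positivePart * L - L * (Q ^ j).positivePart).coeff k)
    {m : ℕ} (ξ : J n m → constants K) (k : ℕ) :
    (combination Q n m ξ * L - L * combination Q n m ξ).coeff k =
      ∑ j, (ξ j : K) * sigma L n k j := by
  rw [combination_apply, Finset.sum_mul, Finset.mul_sum, ← Finset.sum_sub_distrib, coeff_sum]
  refine Finset.sum_congr rfl fun j _ => ?_
  rw [smul_mul_assoc, mul_smul_comm, ← smul_sub, coeff_const_smul, hσ]

/-- Negative coefficients of the commutator vanish because it is a differential operator, those from
`n - 1` up by almost commutation; the remaining ones are the equations of the system. -/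
theorem combination_mem_diffCentralizerLE_iff (hL : L.IsNormalForm n) (hQ : Q.IsMonicOfOrder 1)
    (hQL : Q ^ n = L) (hσ : ∀ k j : ℕ,
      sigma L n k j = ((Q ^ j).positivePart * L - L * (Q ^ j).positivePart).coeff k)
    {m : ℕ} (ξ : J n m → constants K) :
    combination Q n m ξ ∈ diffCentralizerLE L n m ↔ ξ ∈ constSolutions L n m := by
  have hW := combination_mem_almostCommutingLE hL.2.1.2 hQ hQL ξ
  set A := combination Q n m ξ with hA
  constructor
  · intro h k _
    rw [← coeff_commutator_combination hσ ξ k, ← hA, (mem_diffCentralizer.mp h.2).2, sub_self,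
      coeff_zero]
  · intro h
    refine ⟨hW, mem_diffCentralizer.mpr ⟨hW.1.1, ?_⟩⟩
    ext i
    by_cases hi : i < 0
    · rw [(hL.1.mul hW.1.1) i hi, (IsDiffOp.mul hW.1.1 hL.1) i hi]
    · obtain ⟨k, rfl⟩ := Int.eq_ofNat_of_zero_le (not_lt.mp hi)
      rw [← sub_eq_zero, ← coeff_sub]
      by_cases hk : k + 2 ≤ n
      · have := coeff_commutator_combination hσ ξ k
        rw [h k hk, ← hA, coeff_sub, sub_eq_zero] at this
        rw [coeff_sub, this, sub_self]
      · exact hW.1.2 k (by omega)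

theorem constPoly_le_span (hL : L.IsDiffOp) (hQL : Q ^ n = L) :
    Subalgebra.toSubmodule (constPoly L) ≤ Submodule.span (constants K)
      ((fun j => (Q ^ j).positivePart) '' {j | n ∣ j}) := by
  rw [constPoly, Algebra.adjoin_singleton_eq_range_aeval]
  rintro _ ⟨p, rfl⟩
  change Polynomial.aeval L p ∈ _
  rw [Polynomial.aeval_eq_sum_range]
  exact sum_mem fun k _ => Submodule.smul_mem _ _
    (Submodule.subset_span ⟨n * k, dvd_mul_right n k, positivePart_pow_mul hL hQL k⟩)

/-- Disjoint sets of indices, divisible by `n` or not, give disjoint spans in a linearly independent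
family. -/
theorem eq_zero_of_combination_mem_constPoly (hL : L.IsDiffOp) (hQ : Q.IsMonicOfOrder 1)
    (hQL : Q ^ n = L) {m : ℕ} {ξ : J n m → constants K}
    (h : combination Q n m ξ ∈ constPoly L) : ξ = 0 := by
  have hli := linearIndependent_of_isMonicOfOrder (isMonicOfOrder_positivePart_pow hQ)
  have hdis := hli.disjoint_span_image (s := {j | ¬ n ∣ j}) (t := {j | n ∣ j})
    (Set.disjoint_left.mpr fun _ h1 h2 => h1 h2)
  have h0 : combination Q n m ξ = 0 := by
    refine Submodule.disjoint_def.mp hdis _ ?_ (constPoly_le_span hL hQL h)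
    rw [combination_apply]
    exact sum_mem fun j _ => Submodule.smul_mem _ _
      (Submodule.subset_span ⟨j, (Finset.mem_filter.mp j.2).2, rfl⟩)
  rw [combination_apply] at h0
  exact funext (Fintype.linearIndependent_iff.mp (hli.comp _ Subtype.val_injective) ξ h0)

/-- Expand `A` in the positive parts: the indices divisible by `n` contribute powers of `L`, the
others form the combination. -/
theorem exists_sub_combination_mem_constPolyLE [CharZero K] (hn : n ≠ 0) (hL : L.IsNormalForm n)
    (hQ : Q.IsMonicOfOrder 1) (hQL : Q ^ n = L) {m : ℕ} {A : PseudoDiffOp K}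
    (hA : A ∈ almostCommutingLE L n m) :
    ∃ ξ : J n m → constants K, A - combination Q n m ξ ∈ constPolyLE L m := by
  obtain ⟨c, hc⟩ := exists_eq_sum_positivePart hn hL.2.1 hQ hQL (m + 1) A hA.1
    (OrderLE.mono hA.2 (by push_cast; omega))
  refine ⟨fun j => c j, ?_, sub_mem hA.2 (combination_mem_almostCommutingLE hL.2.1.2 hQ hQL _).2⟩
  -- The range starts at `0` and `J n m` at `1`; this is harmless since `n ∣ 0`.
  have hJ : J n m = (Finset.range (m + 1)).filter fun j => ¬ n ∣ j := by
    ext j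
    simp only [J, Finset.mem_filter, Finset.mem_Icc, Finset.mem_range, Nat.lt_succ_iff,
      and_congr_left_iff, and_iff_right_iff_imp]
    rintro h -
    exact Nat.pos_of_ne_zero fun h0 => h (h0 ▸ dvd_zero n)
  have hcomb : combination Q n m (fun j => c j) =
      ∑ j ∈ (Finset.range (m + 1)).filter (fun j => ¬ n ∣ j), c j • (Q ^ j).positivePart := by
    rw [combination_apply, ← hJ]
    exact Finset.sum_coe_sort (J n m) fun j => c j • (Q ^ j).positivePart
  rw [hcomb, hc, ← Finset.sum_filter_add_sum_filter_not _ (fun j => n ∣ j), add_sub_cancel_right]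
  refine sum_mem fun j hj => Submodule.smul_mem _ _ ?_
  obtain ⟨k, rfl⟩ := (Finset.mem_filter.mp hj).2
  rw [positivePart_pow_mul hL.1 hQL]
  exact pow_mem (Algebra.subset_adjoin (Set.mem_singleton L)) k

/-- The isomorphism `V_m ≃ Z_m(L) / C_m[L]`. -/
theorem nonempty_constSolutions_equiv [CharZero K] (hn : n ≠ 0) (hL : L.IsNormalForm n) (m : ℕ) :
    Nonempty (constSolutions L n m ≃ₗ[constants K]
      (L.diffCentralizerLE n m ⧸ (L.constPolyLE m).submoduleOf (L.diffCentralizerLE n m))) := by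
  obtain ⟨Q, hQ, hQL, hσ⟩ := exists_root_sigma hn hL
  have hiff := fun ξ : J n m → constants K =>
    combination_mem_diffCentralizerLE_iff hL hQ hQL hσ ξ
  let f : constSolutions L n m →ₗ[constants K] L.diffCentralizerLE n m :=
    ((combination Q n m).domRestrict _).codRestrict _ fun ξ => (hiff ξ).mpr ξ.2
  refine ⟨LinearEquiv.ofBijective (((L.constPolyLE m).submoduleOf _).mkQ ∘ₗ f) ⟨?_, ?_⟩⟩
  · rw [injective_iff_map_eq_zero]
    intro ξ h
    rw [LinearMap.comp_apply, Submodule.mkQ_apply, Submodule.Quotient.mk_eq_zero] at h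
    exact Subtype.ext (eq_zero_of_combination_mem_constPoly hL.1 hQ hQL h.1)
  · intro x
    obtain ⟨A, rfl⟩ := Submodule.mkQ_surjective _ x
    obtain ⟨ξ, hξ⟩ := exists_sub_combination_mem_constPolyLE hn hL hQ hQL A.2.1
    -- `A` centralizes `L`, and so does its part in `C_m[L]`; hence so does the difference.
    have hZ : combination Q n m ξ ∈ diffCentralizerLE L n m := by
      have := sub_mem A.2 (constPolyLE_le hL.1 n m hξ)
      rwa [sub_sub_cancel] at this
    refine ⟨⟨ξ, (hiff ξ).mp hZ⟩, Eq.symm ?_⟩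
    rw [LinearMap.comp_apply, Submodule.mkQ_apply, Submodule.mkQ_apply, Submodule.Quotient.eq]
    exact hξ

/-- The hypothesis only covers `m` not divisible by `n`. Such `m` are unbounded if `n > 1`, for
instance `n * N + 1`; if `n = 1` there are none, but `J n m` is empty. -/
theorem exists_le_and_forall_isSolution (hn : n ≠ 0)
    (h : ∀ m : ℕ, 0 < m → ¬ n ∣ m → ∀ ξ : J n m → constants K,
      IsSolution L n m (fun j => (ξ j : K)) → ξ = 0) (N : ℕ) :
    ∃ m, N ≤ m ∧ constSolutions L n m = ⊥ := by
  by_cases h1 : n = 1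
  · refine ⟨N, le_rfl, (Submodule.eq_bot_iff _).mpr fun ξ _ => funext fun j => ?_⟩
    exact absurd (Nat.isUnit_iff.mpr h1).dvd (Finset.mem_filter.mp j.2).2
  · refine ⟨n * N + 1, by nlinarith [Nat.pos_of_ne_zero hn],
      (Submodule.eq_bot_iff _).mpr fun ξ hξ => h _ (by omega) ?_ ξ hξ⟩
    rw [Nat.dvd_add_right (dvd_mul_right n N), Nat.dvd_one]
    exact h1

theorem diffCentralizer_eq_constPoly [CharZero K] (hn : n ≠ 0) (hL : L.IsNormalForm n)
    (h : ∀ m : ℕ, 0 < m → ¬ n ∣ m → ∀ ξ : J n m → constants K,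
      IsSolution L n m (fun j => (ξ j : K)) → ξ = 0) :
    L.diffCentralizer = L.constPoly := by
  refine le_antisymm (fun A hA => ?_) (constPoly_le hL.1)
  obtain ⟨N, hN⟩ := A.exists_bound
  obtain ⟨m, hm, hbot⟩ := exists_le_and_forall_isSolution hn h N.toNat
  obtain ⟨e⟩ := nonempty_constSolutions_equiv hn hL m
  obtain ⟨hA1, hA2⟩ := mem_diffCentralizer.mp hA
  have hAm : A ∈ diffCentralizerLE L n m :=
    ⟨⟨⟨hA1, by rw [hA2, sub_self]; exact zero_mem _⟩, fun i hi => hN i (by omega)⟩, hA⟩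
  have hsub : Subsingleton (constSolutions L n m) := by rw [hbot]; infer_instance
  -- The quotient is isomorphic to `V_m = 0`, so the class of `A` vanishes.
  have := (Submodule.Quotient.mk_eq_zero _).mp
    (e.symm.injective.subsingleton.elim (Submodule.Quotient.mk ⟨A, hAm⟩) 0)
  exact this.1

end Solutions

end GelfandDickey

theorem mainTheorem4 {K : Type*} [Field K] [CharZero K] [Differential K]
    (n : ℕ) (hn : 1 ≤ n) (L : PseudoDiffOp K) (hL : L.IsNormalForm n) :
    (∀ m : ℕ, Nonempty (GelfandDickey.constSolutions L n m ≃ₗ[constants K]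
      (L.diffCentralizerLE n m ⧸ (L.constPolyLE m).submoduleOf (L.diffCentralizerLE n m)))) ∧
    ((∀ m : ℕ, 0 < m → ¬ n ∣ m → ∀ ξ : GelfandDickey.J n m → constants K,
        GelfandDickey.IsSolution L n m (fun j => (ξ j : K)) → ξ = 0) →
      L.diffCentralizer = L.constPoly) :=
  ⟨GelfandDickey.nonempty_constSolutions_equiv (by omega) hL,
    GelfandDickey.diffCentralizer_eq_constPoly (by omega) hL⟩
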